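/- Let $D,L\ge 1$ and let $\mathcal S^+_D$ be the set of real symmetric positive definite $D\times D$ matrices. For a symmetric positive definite matrix $V$ and an integer $N>D$ let $$\mathcal W_D(Q\mid V,N)=\frac{\det(Q)^{\frac{N-D-1}{2}}\,e^{-\frac12\operatorname{tr}(V^{-1}Q)}}{\det(V)^{N/2}\,2^{DN/2}\,\pi^{D(D-1)/4}\prod_{k=1}^{D}\Gamma\left(\frac{N-D+k}{2}\right)}$$ be the Wishart density with respect to the Lebesgue measure $dQ=\prod_{i\le j}dQ_{ij}$ on $\mathcal S^+_D$, and let $\mathcal Q_{L,N}$ be the measure on $(\mathcal S^+_D)^L$ given by $$\mathcal Q_{L,N}(dQ_1\cdots dQ_L)=\Big(\prod_{\ell=1}^L\mathcal W_D\big(Q_\ell\mid\tfrac1N\mathbb 1_D,N\big)\Big)\,dQ_1\cdots dQ_L ,$$ where all $L$ layers have the common width $N$. Let $N_0,P\ge1$, let $X$ be a real $N_0\times P$ matrix, let $\lambda_0,\dots,\lambda_L>0$, $\lambda^*=\lambda_0\cdots\lambda_L$, $\beta>0$, and let $\mathbf y=(\mathbf y_1^\top,\dots,\mathbf y_P^\top)^\top\in\mathbb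 R^{DP}$ with $\mathbf y_\mu\in\mathbb R^D$. For $(Q_1,\dots,Q_L)\in(\mathcal S^+_D)^L$ let $U_\ell$ be the Cholesky square root of $Q_\ell$, that is, the upper triangular matrix with positive diagonal entries such that $U_\ell^\top U_\ell=Q_\ell$, and put $$Q^{(L)}=(U_1\cdots U_L)^\top U_1\cdots U_L,\qquad \Sigma_{11}=\frac{X^\top X}{N_0\lambda^*}\otimes Q^{(L)},$$ $$\Phi_\beta(Q_1,\dots,Q_L)=\mathbf y^\top(\Sigma_{11}+\beta^{-1}\mathbb 1_{DP})^{-1}\mathbf y+\log\det(\mathbb 1_{DP}+\beta\Sigma_{11}).$$ The posterior mixing measure is $$\mathcal Q_{L,N}(dQ_1\cdots dQ_L\mid\mathbf y,\beta)=\frac{e^{-\frac12\Phi_\beta(Q_1,\dots,Q_L)}\,\mathcal Q_{L,N}(dQ_1\cdots dQ_L)}{\int_{(\mathcal S^+_D)^L}e^{-\frac12\Phi_\beta}\,d\mathcal Q_{L,N}} .$$ A sequence $(P_N)_N$ of measures on a metric space $\mathbb V$ satisfies a large deviation principle with rate function $I$ if $I:\mathbb V\to[0,+\infty]$ is lower semicontinuous,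 $\limsup_{N\to\infty}\frac1N\log P_N(C)\le-\inf_{v\in C}I(v)$ for every closed $C\subset\mathbb V$, and $\liminf_{N\to\infty}\frac1N\log P_N(O)\ge-\inf_{v\in O}I(v)$ for every open $O\subset\mathbb V$ (with $\log 0=-\infty$ and $\inf\emptyset=+\infty$). Proposition. As $N\to\infty$ with $D$ and $L$ fixed, the measures $\mathcal Q_{L,N}$ satisfy a large deviation principle on $(\mathcal S^+_D)^L$ with rate function $$I(Q_1,\dots,Q_L)=\frac12\sum_{\ell=1}^L\Big(\operatorname{tr}(Q_\ell)-\log\det(Q_\ell)\Big)-\frac{DL}{2}.$$ Moreover, for all $N_0$, $P$, $X$, $\lambda_0,\dots,\lambda_L$, $\beta$ and $\mathbf y$ as above (kept fixed as $N\to\infty$), the posterior mixing measures $\mathcal Q_{L,N}(\,\cdot\mid\mathbf y,\beta)$ satisfy a large deviation principle on $(\mathcal S^+_D)^L$ with the same rate function $I$, whatever $\beta$ and $\mathbf y$ are. -/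

import Mathlib

open Matrix MeasureTheory Filter Topology
open scoped Kronecker ENNReal

noncomputable section

/-- A sequence `P` of measures on `V` satisfies a large deviation principle (with speed `N`) and
rate function `I`: the rate function is a lower semicontinuous map into `[0, ∞]`, and
`limsup (1/N) log P_N(C) ≤ - inf_C I` for closed `C`, `liminf (1/N) log P_N(O) ≥ - inf_O I` for
open `O`. Here `log 0 = -∞` and `inf ∅ = +∞`. -/
structure SatisfiesLDP {V : Type*} [TopologicalSpace V] [MeasurableSpace V]
    (P : ℕ → Measure V) (I : V → EReal) : Prop where
  nonneg : ∀ v, 0 ≤ I v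
  lowerSemicontinuous : LowerSemicontinuous I
  upper_bound : ∀ C : Set V, IsClosed C →
    limsup (fun N : ℕ => ((1 / (N : ℝ) : ℝ) : EReal) * ENNReal.log (P N C)) atTop
      ≤ - ⨅ v ∈ C, I v
  lower_bound : ∀ O : Set V, IsOpen O →
    - ⨅ v ∈ O, I v ≤
      liminf (fun N : ℕ => ((1 / (N : ℝ) : ℝ) : EReal) * ENNReal.log (P N O)) atTop

/-- The cone of real symmetric positive definite `D × D` matrices, with the topology induced by
the topology of the space of matrices. -/
abbrev SPD (D : ℕ) : Type := {Q : Matrix (Fin D) (Fin D) ℝ // Q.PosDef}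

/-- The cone of positive definite matrices carries its Borel σ-algebra. -/
instance instMeasurableSpaceSPD (D : ℕ) : MeasurableSpace (SPD D) := borel (SPD D)

instance instBorelSpaceSPD (D : ℕ) : BorelSpace (SPD D) := ⟨rfl⟩

/-- The coordinates `(Q i j)_{i ≤ j}` of a symmetric matrix. -/
def upperCoords (D : ℕ) (Q : SPD D) : {p : Fin D × Fin D // p.1 ≤ p.2} → ℝ :=
  fun p => Q.1 p.1.1 p.1.2

/-- The Lebesgue measure `dQ = ∏_{i ≤ j} dQ_{ij}` on the cone of positive definite matrices. -/
def lebesgueSPD (D : ℕ) : Measure (SPD D) := Measure.comap (upperCoords D) volume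

/-- The density `𝒲_D(Q | V, N)` of the Wishart distribution with `N` degrees of freedom and scale
matrix `V`, for `N > D`. -/
def wishartDensity (D : ℕ) (V : Matrix (Fin D) (Fin D) ℝ) (N : ℕ) (Q : SPD D) : ℝ :=
  (Q.1.det ^ (((N : ℝ) - D - 1) / 2) * Real.exp (-(1 / 2) * (V⁻¹ * Q.1).trace)) /
    (V.det ^ ((N : ℝ) / 2) * 2 ^ ((D : ℝ) * N / 2) * Real.pi ^ ((D : ℝ) * (D - 1) / 4) *
      ∏ k ∈ Finset.Icc 1 D, Real.Gamma (((N : ℝ) - D + k) / 2))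

/-- The measure `𝒬_{L,N} (dQ_1 ⋯ dQ_L) = (∏_ℓ 𝒲_D(Q_ℓ | 1/N_ℓ, N_ℓ)) dQ_1 ⋯ dQ_L` for layers of
widths `N_1, …, N_L`. -/
def wishartProduct (D L : ℕ) (N : Fin L → ℕ) : Measure (Fin L → SPD D) :=
  (Measure.pi fun _ : Fin L => lebesgueSPD D).withDensity fun Q =>
    ENNReal.ofReal
      (∏ l, wishartDensity D ((1 / (N l : ℝ)) • (1 : Matrix (Fin D) (Fin D) ℝ)) (N l) (Q l))

/-- Every positive definite matrix `Q` is `Uᵀ U` with `U` upper triangular with positive diagonal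
entries. -/
theorem exists_choleskyFactor {D : ℕ} (Q : SPD D) :
    ∃ U : Matrix (Fin D) (Fin D) ℝ,
      (∀ i j, j < i → U i j = 0) ∧ (∀ i, 0 < U i i) ∧ Uᵀ * U = Q.1 := by
  obtain ⟨S, hS⟩ := Q
  have hinv := LDL.invertibleLowerInv hS
  have htri : (LDL.lowerInv hS).BlockTriangular OrderDual.toDual :=
    fun i j hij => LDL.lowerInv_triangular hS hij
  have hL : (LDL.lower hS).BlockTriangular OrderDual.toDual :=
    blockTriangular_inv_of_blockTriangular htri
  have hunit : IsUnit (LDL.lowerInv hS) := isUnit_of_invertible _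
  have hd : (diagonal (LDL.diagEntries hS)).PosDef := by
    have h1 := (Matrix.IsUnit.posDef_star_right_conjugate_iff hunit).2 hS
    have h2 := LDL.diag_eq_lowerInv_conj hS
    rw [LDL.diag] at h2
    rw [h2]; exact h1
  have hdpos : ∀ i, 0 < LDL.diagEntries hS i := posDef_diagonal_iff.1 hd
  have hdet : (LDL.lower hS).det ≠ 0 := by
    have := (Matrix.isUnit_iff_isUnit_det _).1 ((Matrix.isUnit_nonsing_inv_iff).2 hunit)
    exact this.ne_zero
  rw [det_of_isLowerTriangular _ hL, Finset.prod_ne_zero_iff] at hdet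
  have hS' := LDL.lower_conj_diag hS
  set B := LDL.lower hS
  set d := LDL.diagEntries hS
  refine ⟨diagonal (fun i => SignType.sign (B i i) * √(d i)) * Bᵀ, ?_, ?_, ?_⟩
  · intro i j hij
    have : B j i = 0 := hL hij
    simp [diagonal_mul, this]
  · intro i
    have h0 : 0 < |B i i| := abs_pos.2 (hdet i (Finset.mem_univ i))
    have h1 : 0 < √(d i) := Real.sqrt_pos.2 (hdpos i)
    rw [diagonal_mul, transpose_apply, mul_right_comm, sign_mul_self]
    positivity
  · refine Eq.trans ?_ hS'
    rw [LDL.diag, transpose_mul, transpose_transpose, diagonal_transpose,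
      conjTranspose_eq_transpose_of_trivial, ← Matrix.mul_assoc, Matrix.mul_assoc B,
      diagonal_mul_diagonal]
    congr 3
    funext i
    have h1 := Real.mul_self_sqrt (hdpos i).le
    rcases lt_or_gt_of_ne (hdet i (Finset.mem_univ i)) with h | h
    · simp [sign_neg h]; simpa using h1
    · simp [sign_pos h]; simpa using h1

/-- The Cholesky square root of `Q`: the upper triangular matrix `U` with positive diagonal
entries (its transpose is the lower triangular Cholesky factor) and `Uᵀ U = Q`. -/
def choleskyFactor {D : ℕ} (Q : SPD D) : Matrix (Fin D) (Fin D) ℝ :=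
  (exists_choleskyFactor Q).choose

/-- `Q^{(L)}(Q_1, …, Q_L) = (U_1 ⋯ U_L)ᵀ (U_1 ⋯ U_L)`, where `U_ℓ` is the Cholesky square root
of `Q_ℓ`. -/
def layerProduct {D L : ℕ} (Q : Fin L → SPD D) : Matrix (Fin D) (Fin D) ℝ :=
  (List.ofFn fun l => choleskyFactor (Q l)).prodᵀ * (List.ofFn fun l => choleskyFactor (Q l)).prod

/-- `Σ_{11} = (N_0 λ*)⁻¹ Xᵀ X ⊗ Q^{(L)}` with `λ* = λ_0 ⋯ λ_L`. -/
def sigma11 {D L N₀ P : ℕ} (lam : Fin (L + 1) → ℝ) (X : Matrix (Fin N₀) (Fin P) ℝ)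
    (Q : Fin L → SPD D) : Matrix (Fin P × Fin D) (Fin P × Fin D) ℝ :=
  ((1 / ((N₀ : ℝ) * ∏ l, lam l)) • (Xᵀ * X)) ⊗ₖ layerProduct Q

/-- `Φ_β(Q_1, …, Q_L, y) = yᵀ (Σ_{11} + β⁻¹ 1)⁻¹ y + log det (1 + β Σ_{11})`, where `y` is the
stacked vector of the labels `y_1, …, y_P`. -/
def posteriorPotential {D L N₀ P : ℕ} (lam : Fin (L + 1) → ℝ) (X : Matrix (Fin N₀) (Fin P) ℝ)
    (β : ℝ) (y : Fin P → Fin D → ℝ) (Q : Fin L → SPD D) : ℝ :=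
  (fun p : Fin P × Fin D => y p.1 p.2) ⬝ᵥ
      ((sigma11 lam X Q + β⁻¹ • (1 : Matrix (Fin P × Fin D) (Fin P × Fin D) ℝ))⁻¹ *ᵥ
        (fun p : Fin P × Fin D => y p.1 p.2)) +
    Real.log (1 + β • sigma11 lam X Q).det

/-- The posterior mixing measure `𝒬_{L,N}( · | y, β)`: the measure with density `e^{-Φ_β / 2}`
with respect to `𝒬_{L,N}`, normalized by its total mass. -/
def posteriorMixing {D L N₀ P : ℕ} (lam : Fin (L + 1) → ℝ) (X : Matrix (Fin N₀) (Fin P) ℝ)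
    (β : ℝ) (y : Fin P → Fin D → ℝ) (N : Fin L → ℕ) : Measure (Fin L → SPD D) :=
  (∫⁻ Q, ENNReal.ofReal (Real.exp (-(1 / 2) * posteriorPotential lam X β y Q))
      ∂(wishartProduct D L N))⁻¹ •
    (wishartProduct D L N).withDensity fun Q =>
      ENNReal.ofReal (Real.exp (-(1 / 2) * posteriorPotential lam X β y Q))

/-- The rate function `I(Q_1, …, Q_L) = (1/2) ∑_ℓ (tr Q_ℓ - log det Q_ℓ) - D L / 2`. -/
def rateFunction (D L : ℕ) (Q : Fin L → SPD D) : ℝ :=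
  (1 / 2) * ∑ l, ((Q l).1.trace - Real.log (Q l).1.det) - (D : ℝ) * L / 2

end

/-!
On the cone of positive definite matrices the Wishart density with scale matrix `N⁻¹` is a
constant times `det(Q) ^ (-(D + 1) / 2) * exp (-N (tr Q - log det Q) / 2)`, so the large deviation
principle for the product measures is an instance of Laplace's method
(`HasExponentialBounds.of_laplace`). Three facts feed it.

* The normalizing constant is explicit, and Stirling's formula for the Gamma factors gives its
  exponential rate `D L / 2` (`tendsto_log_wishartNormalizer`).
* For `N = D + 1` the power of the determinant disappears and the density without its constant is
  `exp (-(D + 1) tr Q / 2)`. It is integrable because every entry of `Q` is at most `tr Q`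
  (`lintegral_det_rpow_mul_exp_ne_top`). This single integral gives the upper bound for all closed
  sets, including noncompact ones.
* The coordinates `Q i j`, `i ≤ j`, are an open embedding of the cone
  (`isOpenEmbedding_upperCoords`), so open sets have positive Lebesgue measure, which gives the
  lower bound.

The rate is nonnegative since `log det Q ≤ tr Q - D`, and it vanishes when all the matrices are the
identity.

For the posterior, the weight `exp (-Φ / 2)` does not depend on `N`. It is at most `1` as `Φ ≥ 0`,
and it is locally bounded away from zero since `Φ` is bounded by an affine function of
`∏ l, tr (Q l)` (`posteriorPotential_le`), by submultiplicativity of the Frobenius norm. Such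
reweighting, normalization included, does not change the rate (`HasExponentialBounds.tilt`).
-/

/-! ### Large deviations from exponential bounds -/

/-- Exponential bounds with real rate `I` for a sequence of measures: up to any `ε > 0` in the
exponent, `P N C` is at most `exp (-N a)` on closed sets where `I ≥ a`, and `P N O` is at least
`exp (-N I v)` on open sets containing `v`. This is a form of the large deviation principle which
avoids `limsup`, `liminf` and the arithmetic of `EReal`. -/
structure HasExponentialBounds {V : Type*} [TopologicalSpace V] [MeasurableSpace V]
    (P : ℕ → Measure V) (I : V → ℝ) : Prop where
  upper : ∀ C : Set V, IsClosed C → ∀ a : ℝ, (∀ v ∈ C, a ≤ I v) → ∀ ε > 0,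
    ∀ᶠ N : ℕ in atTop, P N C ≤ ENNReal.ofReal (Real.exp (-(N * (a - ε))))
  lower : ∀ O : Set V, IsOpen O → ∀ v ∈ O, ∀ ε > 0,
    ∀ᶠ N : ℕ in atTop, ENNReal.ofReal (Real.exp (-(N * (I v + ε)))) ≤ P N O

theorem one_div_mul_log_ofReal_exp {N : ℕ} (hN : 0 < N) (x : ℝ) :
    ((1 / (N : ℝ) : ℝ) : EReal) * ENNReal.log (ENNReal.ofReal (Real.exp (-(N * x)))) =
      ((-x : ℝ) : EReal) := by
  have hN' : (0 : ℝ) < N := by exact_mod_cast hN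
  rw [ENNReal.log_ofReal_of_pos (Real.exp_pos _), Real.log_exp, ← EReal.coe_mul]
  congr 1
  field_simp

theorem HasExponentialBounds.satisfiesLDP {V : Type*} [TopologicalSpace V] [MeasurableSpace V]
    {P : ℕ → Measure V} {I : V → ℝ} (h : HasExponentialBounds P I) (hI : Continuous I)
    (hI0 : ∀ v, 0 ≤ I v) : SatisfiesLDP P (fun v => (I v : EReal)) where
  nonneg v := by exact_mod_cast hI0 v
  lowerSemicontinuous := (continuous_coe_real_ereal.comp hI).lowerSemicontinuous
  upper_bound C hC := by
    refine EReal.le_of_forall_lt_iff_le.1 fun b hb => ?_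
    obtain ⟨b', hb', hb'b⟩ := EReal.lt_iff_exists_real_btwn.1 hb
    have hbb : b' < b := by exact_mod_cast hb'b
    have hC' : ∀ v ∈ C, -b' ≤ I v := fun v hv => by
      have h1 : ((-b' : ℝ) : EReal) < ⨅ v ∈ C, (I v : EReal) := by
        rw [EReal.coe_neg]; exact EReal.neg_lt_comm.1 hb'
      exact_mod_cast h1.le.trans (iInf₂_le v hv)
    refine limsup_le_of_le (by isBoundedDefault) ?_
    filter_upwards [h.upper C hC (-b') hC' (b - b') (sub_pos.2 hbb), eventually_gt_atTop 0]
      with N hN hN0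
    have hpos : (0 : EReal) ≤ ((1 / (N : ℝ) : ℝ) : EReal) := by
      exact_mod_cast (by positivity : (0 : ℝ) ≤ 1 / (N : ℝ))
    refine (mul_le_mul_of_nonneg_left (ENNReal.log_monotone hN) hpos).trans_eq ?_
    rw [one_div_mul_log_ofReal_exp hN0]
    congr 1
    ring
  lower_bound O hO := by
    refine EReal.neg_le.1 (le_iInf₂ fun v hv => EReal.neg_le.1 ?_)
    refine EReal.ge_of_forall_gt_iff_ge.1 fun b hb => ?_
    have hb' : b < -I v := by exact_mod_cast hb
    refine le_liminf_of_le (by isBoundedDefault) ?_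
    filter_upwards [h.lower O hO v hv (-I v - b) (sub_pos.2 hb'), eventually_gt_atTop 0]
      with N hN hN0
    have hpos : (0 : EReal) ≤ ((1 / (N : ℝ) : ℝ) : EReal) := by
      exact_mod_cast (by positivity : (0 : ℝ) ≤ 1 / (N : ℝ))
    refine Eq.trans_le ?_ (mul_le_mul_of_nonneg_left (ENNReal.log_monotone hN) hpos)
    rw [one_div_mul_log_ofReal_exp hN0]
    congr 1
    ring

theorem eventually_le_exp_natCast_mul (K : ℝ) {ε : ℝ} (hε : 0 < ε) :
    ∀ᶠ N : ℕ in atTop, K ≤ Real.exp (N * ε) :=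
  (Real.tendsto_exp_atTop.comp
    (tendsto_natCast_atTop_atTop.atTop_mul_const hε)).eventually_ge_atTop K

/-- Reweighting by a function `h ≤ 1` that is locally bounded away from zero does not change the
rate, provided the rate is nonnegative with a zero: the normalizing constant, bounded above by the
total mass and below by the mass near that zero, is then negligible on the exponential scale. No
measurability of `h` is used. -/
theorem HasExponentialBounds.tilt {V : Type*} [TopologicalSpace V] [MeasurableSpace V]
    [OpensMeasurableSpace V] {P : ℕ → Measure V} {I : V → ℝ} (hP : HasExponentialBounds P I)
    (hI0 : ∀ v, 0 ≤ I v) {v₀ : V} (hv₀ : I v₀ = 0) {h : V → ℝ≥0∞} (h1 : ∀ v, h v ≤ 1)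
    (hloc : ∀ v, ∃ c : ℝ, 0 < c ∧ ∀ᶠ w in 𝓝 v, ENNReal.ofReal c ≤ h w) :
    HasExponentialBounds (fun N => (∫⁻ v, h v ∂(P N))⁻¹ • (P N).withDensity h) I := by
  have hexp : ∀ x : ℝ, 0 < Real.exp x := Real.exp_pos
  have hlow : ∀ O : Set V, IsOpen O → ∀ v ∈ O, ∀ ε > 0, ∀ᶠ N : ℕ in atTop,
      ENNReal.ofReal (Real.exp (-(N * (I v + ε)))) ≤ ∫⁻ w in O, h w ∂(P N) := by
    intro O hO v hv ε hε
    obtain ⟨c, hc, hcU⟩ := hloc v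
    obtain ⟨U, hU, hUo, hvU⟩ := eventually_nhds_iff.1 hcU
    filter_upwards [hP.lower (O ∩ U) (hO.inter hUo) v ⟨hv, hvU⟩ (ε / 2) (half_pos hε),
      eventually_le_exp_natCast_mul c⁻¹ (half_pos hε)] with N hN hNc
    calc ENNReal.ofReal (Real.exp (-(N * (I v + ε))))
        ≤ ENNReal.ofReal (c * Real.exp (-(N * (I v + ε / 2)))) := by
          apply ENNReal.ofReal_le_ofReal
          have : 1 ≤ c * Real.exp (N * (ε / 2)) := by
            rwa [inv_le_iff_one_le_mul₀' hc] at hNc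
          calc Real.exp (-(N * (I v + ε))) = 1 * Real.exp (-(N * (I v + ε))) := (one_mul _).symm
            _ ≤ c * Real.exp (N * (ε / 2)) * Real.exp (-(N * (I v + ε))) := by gcongr
            _ = c * Real.exp (-(N * (I v + ε / 2))) := by
              rw [mul_assoc, ← Real.exp_add]; ring_nf
      _ = ENNReal.ofReal c * ENNReal.ofReal (Real.exp (-(N * (I v + ε / 2)))) :=
          ENNReal.ofReal_mul hc.le
      _ ≤ ENNReal.ofReal c * P N (O ∩ U) := by gcongr
      _ = ∫⁻ w in O ∩ U, ENNReal.ofReal c ∂(P N) := by rw [setLIntegral_const]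
      _ ≤ ∫⁻ w in O ∩ U, h w ∂(P N) :=
          setLIntegral_mono' (hO.inter hUo).measurableSet fun w hw => hU w hw.2
      _ ≤ ∫⁻ w in O, h w ∂(P N) := lintegral_mono_set Set.inter_subset_left
  have hset : ∀ (N : ℕ) (s : Set V), MeasurableSet s →
      ((∫⁻ v, h v ∂(P N))⁻¹ • (P N).withDensity h) s =
        (∫⁻ v, h v ∂(P N))⁻¹ * ∫⁻ w in s, h w ∂(P N) := by
    intro N s hs
    rw [Measure.smul_apply, smul_eq_mul, withDensity_apply _ hs]
  constructor
  · intro C hC a ha ε hε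
    filter_upwards [hP.upper C hC a ha (ε / 2) (half_pos hε),
      hlow Set.univ isOpen_univ v₀ trivial (ε / 2) (half_pos hε)] with N hN hZ
    rw [hset N C hC.measurableSet]
    rw [hv₀, zero_add, setLIntegral_univ] at hZ
    calc (∫⁻ v, h v ∂(P N))⁻¹ * ∫⁻ w in C, h w ∂(P N)
        ≤ (ENNReal.ofReal (Real.exp (-(N * (ε / 2)))))⁻¹ *
            ENNReal.ofReal (Real.exp (-(N * (a - ε / 2)))) := by
          gcongr
          calc ∫⁻ w in C, h w ∂(P N) ≤ ∫⁻ w in C, 1 ∂(P N) := lintegral_mono h1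
            _ = P N C := by rw [setLIntegral_const, one_mul]
            _ ≤ _ := hN
      _ = ENNReal.ofReal (Real.exp (-(N * (a - ε)))) := by
          rw [← ENNReal.ofReal_inv_of_pos (hexp _), ← ENNReal.ofReal_mul (by positivity),
            ← Real.exp_neg, ← Real.exp_add]
          ring_nf
  · intro O hO v hv ε hε
    filter_upwards [hP.upper Set.univ isClosed_univ 0 (fun v _ => hI0 v) (ε / 2) (half_pos hε),
      hlow O hO v hv (ε / 2) (half_pos hε)] with N hN hZ
    rw [hset N O hO.measurableSet]
    calc ENNReal.ofReal (Real.exp (-(N * (I v + ε))))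
        = (ENNReal.ofReal (Real.exp (-(N * (0 - ε / 2)))))⁻¹ *
            ENNReal.ofReal (Real.exp (-(N * (I v + ε / 2)))) := by
          rw [← ENNReal.ofReal_inv_of_pos (hexp _), ← ENNReal.ofReal_mul (by positivity),
            ← Real.exp_neg, ← Real.exp_add]
          ring_nf
      _ ≤ _ := by
          gcongr
          calc ∫⁻ w, h w ∂(P N) ≤ ∫⁻ w, 1 ∂(P N) := lintegral_mono h1
            _ = P N Set.univ := lintegral_one
            _ ≤ _ := hN

/-- Laplace's method: measures with densities `c N * g * exp (-N F)` have rate `F - κ` if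
`log (c N) / N → κ`. Integrability of a single `g * exp (-M F)` gives the upper bound on all closed
sets, unbounded ones included, so no separate exponential tightness is required. -/
theorem HasExponentialBounds.of_laplace {V : Type*} [TopologicalSpace V] [MeasurableSpace V]
    [OpensMeasurableSpace V] {ν : Measure V} [ν.IsOpenPosMeasure] {F g : V → ℝ}
    (hF : Continuous F) (hg : Continuous g) (hg0 : ∀ v, 0 < g v) {M : ℝ}
    (hM : ∫⁻ v, ENNReal.ofReal (g v * Real.exp (-(M * F v))) ∂ν ≠ ∞)
    {c : ℕ → ℝ} (hc : ∀ᶠ N in atTop, 0 < c N) {κ : ℝ}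
    (hκ : Tendsto (fun N : ℕ => Real.log (c N) / N) atTop (𝓝 κ)) {P : ℕ → Measure V}
    (hP : ∀ᶠ N : ℕ in atTop,
      P N = ν.withDensity fun v => ENNReal.ofReal (c N * g v * Real.exp (-(N * F v)))) :
    HasExponentialBounds P (fun v => F v - κ) := by
  constructor
  · intro C hC a ha ε hε
    set K := (∫⁻ v, ENNReal.ofReal (g v * Real.exp (-(M * F v))) ∂ν).toReal with hK
    have hK0 : 0 ≤ K := ENNReal.toReal_nonneg
    filter_upwards [hP, hc, hκ.eventually_lt_const (by linarith : κ < κ + ε / 2),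
      eventually_le_exp_natCast_mul (Real.exp (M * (a + κ)) * K) (half_pos hε),
      eventually_ge_atTop ⌈M⌉₊, eventually_gt_atTop 0] with N hPN hcN hκN hKN hMN hN0
    have hN0' : (0 : ℝ) < N := by exact_mod_cast hN0
    have hMN' : M ≤ N := Nat.ceil_le.1 hMN
    have hcN' : c N ≤ Real.exp (N * (κ + ε / 2)) := by
      rw [← Real.log_le_iff_le_exp hcN]
      rw [div_lt_iff₀ hN0'] at hκN
      linarith
    rw [hPN, withDensity_apply _ hC.measurableSet]
    calc ∫⁻ v in C, ENNReal.ofReal (c N * g v * Real.exp (-(N * F v))) ∂ν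
        ≤ ∫⁻ v in C, ENNReal.ofReal (c N * Real.exp (-((N - M) * (a + κ)))) *
            ENNReal.ofReal (g v * Real.exp (-(M * F v))) ∂ν := by
          refine setLIntegral_mono' hC.measurableSet fun v hv => ?_
          rw [← ENNReal.ofReal_mul (by positivity)]
          apply ENNReal.ofReal_le_ofReal
          have h1 : a + κ ≤ F v := by have := ha v hv; linarith
          have h2 : Real.exp (-(N * F v)) ≤
              Real.exp (-((N - M) * (a + κ))) * Real.exp (-(M * F v)) := by
            rw [← Real.exp_add, Real.exp_le_exp]
            nlinarith
          have h3 := hg0 v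
          calc c N * g v * Real.exp (-(N * F v))
              ≤ c N * g v * (Real.exp (-((N - M) * (a + κ))) * Real.exp (-(M * F v))) := by
                gcongr
            _ = _ := by ring
      _ ≤ ∫⁻ v, ENNReal.ofReal (c N * Real.exp (-((N - M) * (a + κ)))) *
            ENNReal.ofReal (g v * Real.exp (-(M * F v))) ∂ν := setLIntegral_le_lintegral _ _
      _ = ENNReal.ofReal (c N * Real.exp (-((N - M) * (a + κ)))) * ENNReal.ofReal K := by
          rw [lintegral_const_mul' _ _ ENNReal.ofReal_ne_top, hK, ENNReal.ofReal_toReal hM]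
      _ ≤ _ := by
          rw [← ENNReal.ofReal_mul (by positivity)]
          apply ENNReal.ofReal_le_ofReal
          calc c N * Real.exp (-((N - M) * (a + κ))) * K
              ≤ Real.exp (N * (κ + ε / 2)) * Real.exp (-((N - M) * (a + κ))) * K := by gcongr
            _ = Real.exp (-(N * (a - ε / 2))) * (Real.exp (M * (a + κ)) * K) := by
                rw [← mul_assoc, ← Real.exp_add, ← Real.exp_add]; ring_nf
            _ ≤ Real.exp (-(N * (a - ε / 2))) * Real.exp (N * (ε / 2)) := by gcongr
            _ = Real.exp (-(N * (a - ε))) := by rw [← Real.exp_add]; ring_nf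
  · intro O hO v hv ε hε
    set U := O ∩ ({w | F w < F v + ε / 3} ∩ {w | g v / 2 < g w}) with hU
    have hUo : IsOpen U :=
      hO.inter ((isOpen_lt hF continuous_const).inter (isOpen_lt continuous_const hg))
    have hvU : v ∈ U :=
      ⟨hv, by simp only [Set.mem_ofPred_eq]; linarith, by
        simp only [Set.mem_ofPred_eq]; linarith [hg0 v]⟩
    obtain ⟨m, hm0, hmU⟩ : ∃ m : ℝ, 0 < m ∧ ENNReal.ofReal m ≤ ν U := by
      have hpos : ν U ≠ 0 := (hUo.measure_pos ν ⟨v, hvU⟩).ne'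
      refine ⟨(min (ν U) 1).toReal, ENNReal.toReal_pos ?_ ?_, ENNReal.ofReal_toReal_le.trans
        (min_le_left _ _)⟩
      · simp [min_eq_iff, hpos]
      · exact ne_top_of_le_ne_top ENNReal.one_ne_top (min_le_right _ _)
    have hgm : 0 < g v / 2 * m := mul_pos (half_pos (hg0 v)) hm0
    filter_upwards [hP, hc, hκ.eventually_const_lt (by linarith : κ - ε / 3 < κ),
      eventually_le_exp_natCast_mul (g v / 2 * m)⁻¹ (by positivity : 0 < ε / 3),
      eventually_gt_atTop 0] with N hPN hcN hκN hKN hN0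
    have hN0' : (0 : ℝ) < N := by exact_mod_cast hN0
    have hcN' : Real.exp (N * (κ - ε / 3)) ≤ c N := by
      rw [← Real.le_log_iff_exp_le hcN]
      rw [lt_div_iff₀ hN0'] at hκN
      linarith
    rw [inv_le_iff_one_le_mul₀' hgm] at hKN
    rw [hPN, withDensity_apply _ hO.measurableSet]
    calc ENNReal.ofReal (Real.exp (-(N * (F v - κ + ε))))
        ≤ ENNReal.ofReal (c N * (g v / 2) * Real.exp (-(N * (F v + ε / 3))) * m) := by
          apply ENNReal.ofReal_le_ofReal
          calc Real.exp (-(N * (F v - κ + ε)))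
              = 1 * Real.exp (-(N * (F v - κ + ε))) := (one_mul _).symm
            _ ≤ g v / 2 * m * Real.exp (N * (ε / 3)) * Real.exp (-(N * (F v - κ + ε))) := by
                gcongr
            _ = Real.exp (N * (κ - ε / 3)) * (g v / 2 * Real.exp (-(N * (F v + ε / 3))) * m) := by
                have h : Real.exp (N * (ε / 3)) * Real.exp (-(N * (F v - κ + ε))) =
                    Real.exp (N * (κ - ε / 3)) * Real.exp (-(N * (F v + ε / 3))) := by
                  rw [← Real.exp_add, ← Real.exp_add]; ring_nf
                linear_combination (g v / 2 * m) * h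
            _ ≤ c N * (g v / 2 * Real.exp (-(N * (F v + ε / 3))) * m) := by
                have := hg0 v
                gcongr
            _ = _ := by ring
      _ = ENNReal.ofReal (c N * (g v / 2) * Real.exp (-(N * (F v + ε / 3)))) *
            ENNReal.ofReal m := ENNReal.ofReal_mul (by have := hg0 v; positivity)
      _ ≤ ENNReal.ofReal (c N * (g v / 2) * Real.exp (-(N * (F v + ε / 3)))) * ν U := by gcongr
      _ = ∫⁻ w in U, ENNReal.ofReal (c N * (g v / 2) * Real.exp (-(N * (F v + ε / 3)))) ∂ν := by
          rw [setLIntegral_const]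
      _ ≤ ∫⁻ w in U, ENNReal.ofReal (c N * g w * Real.exp (-(N * F w))) ∂ν := by
          refine setLIntegral_mono' hUo.measurableSet fun w hw => ENNReal.ofReal_le_ofReal ?_
          have h2 : F w < F v + ε / 3 := hw.2.1
          have h3 : g v / 2 < g w := hw.2.2
          have := hg0 w
          gcongr
      _ ≤ _ := lintegral_mono_set Set.inter_subset_left

/-! ### Stirling's formula and the normalizing constant -/

theorem tendsto_log_factorial_div_sub_log :
    Tendsto (fun n : ℕ => Real.log (n.factorial : ℝ) / n - Real.log n) atTop (𝓝 (-1)) := by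
  have hlog : Tendsto (fun n : ℕ => Real.log (n : ℝ) / n) atTop (𝓝 0) :=
    (Real.isLittleO_log_id_atTop.tendsto_div_nhds_zero).comp tendsto_natCast_atTop_atTop
  have hinv : Tendsto (fun n : ℕ => ((n : ℝ))⁻¹) atTop (𝓝 0) := tendsto_inv_atTop_nhds_zero_nat
  have hst : Tendsto (fun n : ℕ => Real.log (Stirling.stirlingSeq n)) atTop
      (𝓝 (Real.log (√Real.pi))) :=
    Stirling.tendsto_stirlingSeq_sqrt_pi.log (Real.sqrt_pos.2 Real.pi_pos).ne'
  have h := (((hst.add_const (Real.log 2 / 2)).mul hinv).add (hlog.mul_const (1 / 2))).sub_const 1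
  simp only [mul_zero, zero_mul, add_zero, zero_sub] at h
  refine h.congr' ?_
  filter_upwards [eventually_gt_atTop 0] with n hn
  have hn' : (0 : ℝ) < n := by exact_mod_cast hn
  rw [Stirling.log_stirlingSeq_formula, Real.log_mul two_ne_zero hn'.ne',
    Real.log_div hn'.ne' (Real.exp_pos 1).ne', Real.log_exp]
  field_simp
  ring

theorem tendsto_log_Gamma_div_sub_log :
    Tendsto (fun x : ℝ => Real.log (Real.Gamma x) / x - Real.log x) atTop (𝓝 (-1)) := by
  have hlog : Tendsto (fun x : ℝ => Real.log x / x) atTop (𝓝 0) :=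
    Real.isLittleO_log_id_atTop.tendsto_div_nhds_zero
  have hfl : Tendsto (fun x : ℝ => (⌊x⌋₊ : ℝ) / x) atTop (𝓝 1) := tendsto_nat_floor_div_atTop
  have hfac := tendsto_log_factorial_div_sub_log.comp (tendsto_nat_floor_atTop (α := ℝ))
  -- `log Γ(x)` differs from `log ⌊x⌋!` by at most `log x`
  have h1 : Tendsto (fun x : ℝ => (Real.log (Real.Gamma x) -
      Real.log ((⌊x⌋₊).factorial : ℝ)) / x) atTop (𝓝 0) := by
    refine tendsto_of_tendsto_of_tendsto_of_le_of_le' (by simpa using hlog.neg)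
      tendsto_const_nhds ?_ ?_
    all_goals
      filter_upwards [eventually_ge_atTop 3] with x hx
      obtain ⟨m, hm⟩ : ∃ m, ⌊x⌋₊ = m + 1 := Nat.exists_eq_succ_of_ne_zero
        (Nat.floor_pos.2 (by linarith)).ne'
      have hm1 : (2 : ℝ) ≤ m := by
        have : 3 ≤ ⌊x⌋₊ := Nat.le_floor (by exact_mod_cast hx)
        exact_mod_cast (by lia : 2 ≤ m)
      have hle : (m : ℝ) + 1 ≤ x := by
        have := Nat.floor_le (by linarith : 0 ≤ x)
        rw [hm] at this; exact_mod_cast this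
      have hlt : x < (m : ℝ) + 1 + 1 := by
        have := Nat.lt_floor_add_one x
        rw [hm] at this; exact_mod_cast this
      have hmono := Real.Gamma_strictMonoOn_Ici.monotoneOn
      have hG := Real.Gamma_pos_of_pos (by linarith : 0 < x)
    · have h := hmono (by simp; linarith) (by simp; linarith) hle
      rw [Real.Gamma_nat_eq_factorial] at h
      have hf : (0 : ℝ) < (m.factorial : ℝ) := by exact_mod_cast m.factorial_pos
      have h2 := Real.log_le_log hf h
      have h3 := Real.log_le_log (by positivity) hle
      rw [← neg_div]
      gcongr
      rw [hm, Nat.factorial_succ, Nat.cast_mul, Real.log_mul (by positivity) hf.ne']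
      push_cast
      linarith
    · have h := hmono (by simp; linarith) (by simp; linarith) hlt.le
      have h4 : ((m : ℝ) + 1 + 1) = ((m + 1 : ℕ) : ℝ) + 1 := by push_cast; ring
      rw [h4, Real.Gamma_nat_eq_factorial] at h
      have h2 := Real.log_le_log hG h
      rw [hm]
      exact div_nonpos_of_nonpos_of_nonneg (by linarith) (by linarith)
  have h2 : Tendsto (fun x : ℝ => ((⌊x⌋₊ : ℝ) / x - 1) * Real.log x) atTop (𝓝 0) := by
    refine squeeze_zero_norm' ?_ hlog
    filter_upwards [eventually_ge_atTop 1] with x hx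
    have hx0 : 0 < x := by linarith
    have ha := Nat.floor_le hx0.le
    have hb := Nat.lt_floor_add_one x
    have hl := Real.log_nonneg hx
    rw [norm_mul, Real.norm_of_nonneg hl, div_eq_inv_mul (Real.log x)]
    gcongr
    rw [Real.norm_eq_abs, abs_le]
    constructor
    · rw [← sub_nonneg]; field_simp; linarith
    · rw [← sub_nonneg]; field_simp; linarith
  have h3 : Tendsto (fun x : ℝ => (⌊x⌋₊ : ℝ) / x * Real.log ((⌊x⌋₊ : ℝ) / x)) atTop (𝓝 0) := by
    simpa using hfl.mul (hfl.log one_ne_zero)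
  have h := ((h1.add (hfl.mul hfac)).add h2).add h3
  simp only [zero_add, add_zero, one_mul] at h
  refine h.congr' ?_
  filter_upwards [eventually_ge_atTop 1] with x hx
  have hn : (0 : ℝ) < ⌊x⌋₊ := by exact_mod_cast Nat.floor_pos.2 hx
  have hx0 : 0 < x := by linarith
  simp only [Function.comp]
  rw [Real.log_div hn.ne' hx0.ne']
  field_simp
  ring

theorem tendsto_log_Gamma_shift (j : ℝ) :
    Tendsto (fun N : ℕ => Real.log (Real.Gamma (((N : ℝ) + j) / 2)) / N - Real.log (N / 2) / 2)
      atTop (𝓝 (-(1 / 2))) := by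
  have hx : Tendsto (fun N : ℕ => ((N : ℝ) + j) / 2) atTop atTop :=
    (tendsto_atTop_add_const_right _ j tendsto_natCast_atTop_atTop).atTop_div_const two_pos
  have hinv : Tendsto (fun n : ℕ => ((n : ℝ))⁻¹) atTop (𝓝 0) := tendsto_inv_atTop_nhds_zero_nat
  have hratio : Tendsto (fun N : ℕ => ((N : ℝ) + j) / 2 / N) atTop (𝓝 (1 / 2)) := by
    have h := (hinv.const_mul (j / 2)).const_add (1 / 2)
    rw [mul_zero, add_zero] at h
    refine h.congr' ?_
    filter_upwards [eventually_gt_atTop 0] with N hN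
    have hN' : (0 : ℝ) < N := by exact_mod_cast hN
    field_simp
  have hlog : Tendsto (fun N : ℕ => Real.log (((N : ℝ) + j) / 2) / (((N : ℝ) + j) / 2)) atTop
      (𝓝 0) := (Real.isLittleO_log_id_atTop.tendsto_div_nhds_zero).comp hx
  have h1 := hratio.mul (tendsto_log_Gamma_div_sub_log.comp hx)
  have h2 : Tendsto (fun N : ℕ => Real.log (2 * (((N : ℝ) + j) / 2 / N)) / 2) atTop (𝓝 0) := by
    have := ((hratio.const_mul 2).log (by norm_num)).div_const 2
    simpa using this
  have h3 := (hlog.mul hratio).const_mul (j / 2)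
  have h := (h1.add h2).add h3
  rw [zero_mul, mul_zero, add_zero, add_zero, mul_neg_one] at h
  refine h.congr' ?_
  filter_upwards [eventually_gt_atTop 0, hx.eventually_gt_atTop 0] with N hN hxN
  have hN' : (0 : ℝ) < N := by exact_mod_cast hN
  have hj : 0 < (N : ℝ) + j := by linarith
  simp only [Function.comp]
  rw [show 2 * (((N : ℝ) + j) / 2 / N) = ((N + j) / 2) / (N / 2) by field_simp,
    Real.log_div hxN.ne' (by positivity)]
  field_simp
  ring

/-- The normalizing constant of the Wishart density with scale matrix `(1 / N) • 1`. -/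
noncomputable def wishartNormalizer (D N : ℕ) : ℝ :=
  ((1 / (N : ℝ)) • (1 : Matrix (Fin D) (Fin D) ℝ)).det ^ ((N : ℝ) / 2) *
    2 ^ ((D : ℝ) * N / 2) * Real.pi ^ ((D : ℝ) * (D - 1) / 4) *
      ∏ k ∈ Finset.Icc 1 D, Real.Gamma (((N : ℝ) - D + k) / 2)

theorem Gamma_arg_pos {D N : ℕ} (hN : D < N) (k : ℕ) : 0 < ((N : ℝ) - D + k) / 2 := by
  have : (D : ℝ) < N := by exact_mod_cast hN
  have : (0 : ℝ) ≤ k := k.cast_nonneg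
  linarith

theorem wishartNormalizer_pos {D N : ℕ} (hN : D < N) : 0 < wishartNormalizer D N := by
  have hN' : (0 : ℝ) < N := by exact_mod_cast (Nat.zero_le D).trans_lt hN
  have h := Finset.prod_pos fun k (_ : k ∈ Finset.Icc 1 D) =>
    Real.Gamma_pos_of_pos (Gamma_arg_pos hN k)
  have hd : 0 < ((1 / (N : ℝ)) • (1 : Matrix (Fin D) (Fin D) ℝ)).det := by
    rw [det_smul, det_one]; positivity
  have := Real.pi_pos
  unfold wishartNormalizer
  positivity

theorem tendsto_log_wishartNormalizer (D : ℕ) :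
    Tendsto (fun N : ℕ => Real.log (wishartNormalizer D N) / N) atTop (𝓝 (-(D / 2 : ℝ))) := by
  have hinv : Tendsto (fun n : ℕ => ((n : ℝ))⁻¹) atTop (𝓝 0) := tendsto_inv_atTop_nhds_zero_nat
  have hG := tendsto_finsetSum (Finset.Icc 1 D) fun k _ => tendsto_log_Gamma_shift (-(D : ℝ) + k)
  have h := (hinv.const_mul (Real.log (Real.pi ^ ((D : ℝ) * (D - 1) / 4)))).add hG
  rw [Finset.sum_const, Nat.card_Icc, mul_zero, zero_add, Nat.add_sub_cancel, nsmul_eq_mul] at h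
  rw [show -(D / 2 : ℝ) = D * -(1 / 2) by ring]
  refine h.congr' ?_
  filter_upwards [eventually_gt_atTop D] with N hN
  have hN' : (0 : ℝ) < N := by exact_mod_cast (Nat.zero_le D).trans_lt hN
  have hΓ : ∀ k ∈ Finset.Icc 1 D, Real.Gamma (((N : ℝ) - D + k) / 2) ≠ 0 := fun k _ =>
    (Real.Gamma_pos_of_pos (Gamma_arg_pos hN k)).ne'
  have hd : 0 < (1 / (N : ℝ)) ^ D := by positivity
  have hπ := Real.pi_pos
  rw [wishartNormalizer, det_smul, det_one, mul_one, Fintype.card_fin,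
    Real.log_mul (by positivity) (Finset.prod_ne_zero_iff.2 hΓ), Real.log_mul (by positivity)
      (by positivity), Real.log_mul (by positivity) (by positivity), Real.log_prod hΓ,
    Real.log_rpow hd, Real.log_pow, Real.log_rpow two_pos, Finset.sum_sub_distrib,
    Finset.sum_const, Nat.card_Icc, Nat.add_sub_cancel, nsmul_eq_mul,
    Real.log_div hN'.ne' two_ne_zero, one_div, Real.log_inv, ← Finset.sum_div]
  simp only [← add_assoc, ← sub_eq_add_neg]
  field_simp
  ring

/-! ### Positive definite matrices and their Lebesgue measure -/

/-- Positive definite matrices form an open subset of the symmetric ones: positivity of the quadratic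
form on the compact unit sphere persists under small perturbations. -/
theorem Matrix.PosDef.eventually_posDef {n : Type*} [Fintype n] {A : Matrix n n ℝ}
    (hA : A.PosDef) : ∀ᶠ B in 𝓝 A, B.IsHermitian → B.PosDef := by
  classical
  have h : ∀ᶠ B in 𝓝 A, ∀ x ∈ Metric.sphere (0 : n → ℝ) 1, 0 < x ⬝ᵥ (B *ᵥ x) := by
    refine (isCompact_sphere 0 1).eventually_forall_of_forall_eventually fun x hx => ?_
    have hc : Continuous fun z : Matrix n n ℝ × (n → ℝ) => z.2 ⬝ᵥ (z.1 *ᵥ z.2) := by fun_prop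
    refine hc.continuousAt.eventually_const_lt ?_
    have hx0 : x ≠ 0 := by
      rintro rfl
      simp at hx
    simpa using hA.dotProduct_mulVec_pos hx0
  filter_upwards [h] with B hB hBh
  refine PosDef.of_dotProduct_mulVec_pos hBh fun x hx => ?_
  have hn : 0 < ‖x‖ := norm_pos_iff.2 hx
  have h1 := hB (‖x‖⁻¹ • x) (by simp [norm_smul, hn.ne'])
  rw [mulVec_smul, dotProduct_smul, smul_dotProduct, smul_eq_mul, smul_eq_mul] at h1
  simpa [hn] using h1

theorem Matrix.PosSemidef.abs_apply_le_trace {n : Type*} [Fintype n] {A : Matrix n n ℝ}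
    (hA : A.PosSemidef) (i j : n) : |A i j| ≤ A.trace := by
  classical
  have hd : ∀ k, A k k ≤ A.trace := fun k =>
    Finset.single_le_sum (f := fun k => A k k) (fun k _ => hA.diag_nonneg) (Finset.mem_univ k)
  -- test the quadratic form at `e_i + e_j` and `e_i - e_j`
  have hs : A j i = A i j := by simpa using hA.1.apply i j
  have hp := hA.dotProduct_mulVec_nonneg (Pi.single i 1 + Pi.single j 1)
  have hm := hA.dotProduct_mulVec_nonneg (Pi.single i 1 - Pi.single j 1)
  simp [mulVec_add, mulVec_sub, add_dotProduct, sub_dotProduct, hs] at hp hm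
  rw [abs_le]
  constructor <;> linarith [hd i, hd j]

theorem Matrix.PosDef.log_det_le_trace_sub_card {n : Type*} [Fintype n] [DecidableEq n]
    {A : Matrix n n ℝ} (hA : A.PosDef) : Real.log A.det ≤ A.trace - Fintype.card n := by
  have hpos := hA.eigenvalues_pos
  rw [hA.1.det_eq_prod_eigenvalues, hA.1.trace_eq_sum_eigenvalues]
  simp only [RCLike.ofReal_real_eq_id, id_eq]
  rw [Real.log_prod fun i _ => (hpos i).ne']
  calc ∑ i, Real.log (hA.1.eigenvalues i) ≤ ∑ i, (hA.1.eigenvalues i - 1) :=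
        Finset.sum_le_sum fun i _ => Real.log_le_sub_one_of_pos (hpos i)
    _ = _ := by simp

/-- The symmetric matrix with the given coordinates on and above the diagonal. -/
def symmOfUpper (D : ℕ) (v : {p : Fin D × Fin D // p.1 ≤ p.2} → ℝ) :
    Matrix (Fin D) (Fin D) ℝ :=
  fun i j => if h : i ≤ j then v ⟨(i, j), h⟩ else v ⟨(j, i), (not_le.1 h).le⟩

theorem continuous_symmOfUpper (D : ℕ) : Continuous (symmOfUpper D) := by
  refine continuous_matrix fun i j => ?_
  unfold symmOfUpper
  split_ifs <;> exact continuous_apply _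

theorem isHermitian_symmOfUpper {D : ℕ} (v : {p : Fin D × Fin D // p.1 ≤ p.2} → ℝ) :
    (symmOfUpper D v).IsHermitian := by
  ext i j
  rcases lt_trichotomy i j with h | rfl | h
  · simp [symmOfUpper, h.le, not_le.2 h]
  · simp
  · simp [symmOfUpper, h.le, not_le.2 h]

theorem symmOfUpper_upperCoords {D : ℕ} (Q : SPD D) : symmOfUpper D (upperCoords D Q) = Q.1 := by
  ext i j
  unfold symmOfUpper upperCoords
  split_ifs
  · rfl
  · simpa using Q.2.1.apply i j

/-- In particular `upperCoords` is a measurable embedding, so that the `comap` in `lebesgueSPD` is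
not the junk value `0`. -/
theorem isOpenEmbedding_upperCoords (D : ℕ) : IsOpenEmbedding (upperCoords D) := by
  have hcont : Continuous (upperCoords D) :=
    continuous_pi fun p => (continuous_subtype_val.matrix_elem p.1.1 p.1.2)
  have hinj : Function.Injective (upperCoords D) := fun Q R h =>
    Subtype.ext (by rw [← symmOfUpper_upperCoords Q, ← symmOfUpper_upperCoords R, h])
  refine .of_continuous_injective_isOpenMap hcont hinj fun U hU => ?_
  obtain ⟨W, hW, rfl⟩ := isOpen_induced_iff.1 hU
  have himg : upperCoords D '' (Subtype.val ⁻¹' W) =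
      {v | symmOfUpper D v ∈ W ∧ (symmOfUpper D v).PosDef} := by
    ext v
    constructor
    · rintro ⟨Q, hQ, rfl⟩
      simp only [Set.mem_ofPred_eq, symmOfUpper_upperCoords]
      exact ⟨hQ, Q.2⟩
    · rintro ⟨h1, h2⟩
      refine ⟨⟨_, h2⟩, h1, ?_⟩
      ext p
      simp [upperCoords, symmOfUpper, p.2]
  rw [himg, isOpen_iff_eventually]
  rintro v ⟨h1, h2⟩
  have hc := (continuous_symmOfUpper D).tendsto v
  filter_upwards [hc.eventually (hW.mem_nhds h1), hc.eventually h2.eventually_posDef] with w hw hw'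
  exact ⟨hw, hw' (isHermitian_symmOfUpper w)⟩

instance instSecondCountableTopologySPD (D : ℕ) : SecondCountableTopology (SPD D) :=
  (isOpenEmbedding_upperCoords D).isEmbedding.secondCountableTopology

theorem map_upperCoords_lebesgueSPD (D : ℕ) :
    (lebesgueSPD D).map (upperCoords D) = volume.restrict (Set.range (upperCoords D)) :=
  (isOpenEmbedding_upperCoords D).measurableEmbedding.map_comap volume

instance instSigmaFiniteLebesgueSPD (D : ℕ) : SigmaFinite (lebesgueSPD D) := by
  refine SigmaFinite.of_map (lebesgueSPD D) (f := upperCoords D)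
    (isOpenEmbedding_upperCoords D).measurableEmbedding.measurable.aemeasurable ?_
  rw [map_upperCoords_lebesgueSPD]
  infer_instance

instance instIsOpenPosMeasureLebesgueSPD (D : ℕ) : (lebesgueSPD D).IsOpenPosMeasure :=
  Measure.IsOpenPosMeasure.comap volume (isOpenEmbedding_upperCoords D)

theorem integrable_exp_neg_mul_abs {c : ℝ} (hc : 0 < c) :
    Integrable fun x : ℝ => Real.exp (-(c * |x|)) := by
  rw [← integrableOn_univ, ← Set.Iic_union_Ioi (a := (0 : ℝ))]
  refine IntegrableOn.union ?_ ?_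
  · refine (integrableOn_exp_mul_Iic hc 0).congr_fun (fun x hx => ?_) measurableSet_Iic
    simp only [abs_of_nonpos (Set.mem_Iic.1 hx)]
    ring_nf
  · refine (exp_neg_integrableOn_Ioi 0 hc).congr_fun (fun x hx => ?_) measurableSet_Ioi
    simp only [abs_of_pos (Set.mem_Ioi.1 hx)]
    ring_nf

/-- All coordinates of a positive definite matrix are bounded by its trace, so the integrand is
dominated by a product of integrable functions of the single coordinates. -/
theorem integrable_exp_neg_mul_trace (D : ℕ) {c : ℝ} (hc : 0 < c) :
    Integrable (fun Q : SPD D => Real.exp (-(c * Q.1.trace))) (lebesgueSPD D) := by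
  set ι := {p : Fin D × Fin D // p.1 ≤ p.2}
  -- `+ 1` keeps the denominator nonzero when there are no coordinates, that is, for `D = 0`
  set b : ℝ := c / (Fintype.card ι + 1) with hb
  have hb0 : 0 < b := by positivity
  have hem := (isOpenEmbedding_upperCoords D).measurableEmbedding
  have hprod : Integrable (fun v : ι → ℝ => ∏ p, Real.exp (-(b * |v p|))) :=
    Integrable.fintype_prod (𝕜 := ℝ) (f := fun _ : ι => fun x : ℝ => Real.exp (-(b * |x|)))
      fun _ => integrable_exp_neg_mul_abs hb0
  have hint : Integrable (fun Q : SPD D => ∏ p, Real.exp (-(b * |upperCoords D Q p|)))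
      (lebesgueSPD D) := by
    have h := hprod.mono_measure
      (Measure.restrict_le_self (s := Set.range (upperCoords D)))
    rw [← map_upperCoords_lebesgueSPD] at h
    exact (hem.integrable_map_iff.1 h)
  have hcont : Continuous fun Q : SPD D => Real.exp (-(c * Q.1.trace)) := by fun_prop
  refine hint.mono' hcont.measurable.aestronglyMeasurable (ae_of_all _ fun Q => ?_)
  rw [Real.norm_of_nonneg (Real.exp_pos _).le, ← Real.exp_sum, Real.exp_le_exp,
    Finset.sum_neg_distrib, neg_le_neg_iff]
  have ht : 0 ≤ Q.1.trace := Q.2.posSemidef.trace_nonneg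
  calc ∑ p, b * |upperCoords D Q p| ≤ ∑ _p : ι, b * Q.1.trace := by
        gcongr with p
        exact Q.2.posSemidef.abs_apply_le_trace _ _
    _ = b * Fintype.card ι * Q.1.trace := by
        rw [Finset.sum_const, Finset.card_univ, nsmul_eq_mul]; ring
    _ ≤ c * Q.1.trace := by
        gcongr
        rw [hb, div_mul_eq_mul_div, div_le_iff₀ (by positivity)]
        nlinarith

/-! ### Bounds for the posterior potential -/

theorem Matrix.trace_transpose_mul_self {m n : Type*} [Fintype m] [Fintype n]
    (A : Matrix m n ℝ) : (Aᵀ * A).trace = ∑ i, ∑ j, A i j ^ 2 := by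
  simp only [trace, diag_apply, mul_apply, transpose_apply, ← pow_two]
  exact Finset.sum_comm

/-- Submultiplicativity of the squared Frobenius norm. -/
theorem Matrix.trace_transpose_mul_self_mul_le {l m n : Type*} [Fintype l] [Fintype m] [Fintype n]
    (A : Matrix l m ℝ) (B : Matrix m n ℝ) :
    ((A * B)ᵀ * (A * B)).trace ≤ (Aᵀ * A).trace * (Bᵀ * B).trace := by
  simp only [trace_transpose_mul_self]
  calc ∑ i, ∑ j, (A * B) i j ^ 2 ≤ ∑ i, ∑ j, (∑ k, A i k ^ 2) * ∑ k, B k j ^ 2 := by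
        gcongr with i _ j
        rw [mul_apply]
        exact Finset.sum_mul_sq_le_sq_mul_sq _ _ _
    _ = _ := by
        rw [Finset.sum_comm (s := (Finset.univ : Finset m)) (t := (Finset.univ : Finset n)),
          Finset.sum_mul_sum]

theorem Matrix.trace_transpose_mul_self_list_prod_le {n : Type*} [Fintype n] [DecidableEq n]
    (l : List (Matrix n n ℝ)) :
    (l.prodᵀ * l.prod).trace ≤ Fintype.card n * (l.map fun A => (Aᵀ * A).trace).prod := by
  induction l with
  | nil => simp
  | cons A l ih =>
    rw [List.prod_cons, List.map_cons, List.prod_cons, mul_left_comm]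
    refine (trace_transpose_mul_self_mul_le A l.prod).trans ?_
    gcongr
    rw [trace_transpose_mul_self]
    positivity

theorem choleskyFactor_transpose_mul_self {D : ℕ} (Q : SPD D) :
    (choleskyFactor Q)ᵀ * choleskyFactor Q = Q.1 :=
  (exists_choleskyFactor Q).choose_spec.2.2

/-- The Cholesky factors enter only through `tr (Uᵀ U) = tr Q`, so their continuity in `Q` plays no
role. The factor `D` is the trace of the empty product, needed for `L = 0`. -/
theorem trace_layerProduct_le {D L : ℕ} (Q : Fin L → SPD D) :
    (layerProduct Q).trace ≤ D * ∏ l, (Q l).1.trace := by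
  have h := trace_transpose_mul_self_list_prod_le (List.ofFn fun l => choleskyFactor (Q l))
  rw [List.map_ofFn, List.prod_ofFn, Fintype.card_fin] at h
  simp only [Function.comp_apply, choleskyFactor_transpose_mul_self] at h
  exact h

theorem posSemidef_layerProduct {D L : ℕ} (Q : Fin L → SPD D) : (layerProduct Q).PosSemidef := by
  simpa [layerProduct] using
    posSemidef_conjTranspose_mul_self (List.ofFn fun l => choleskyFactor (Q l)).prod

theorem posSemidef_sigma11 {D L N₀ P : ℕ} {lam : Fin (L + 1) → ℝ} (hlam : ∀ l, 0 < lam l)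
    (X : Matrix (Fin N₀) (Fin P) ℝ) (Q : Fin L → SPD D) : (sigma11 lam X Q).PosSemidef := by
  have hX : (Xᵀ * X).PosSemidef := by simpa using posSemidef_conjTranspose_mul_self X
  have hl := Finset.prod_pos fun l (_ : l ∈ Finset.univ) => hlam l
  exact (hX.smul (by positivity)).kronecker (posSemidef_layerProduct Q)

/-- The eigenvalues of `1 + A` are Rayleigh quotients at unit eigenvectors, hence at least `1`. -/
theorem Matrix.PosSemidef.one_le_det_one_add {n : Type*} [Fintype n] [DecidableEq n]
    {A : Matrix n n ℝ} (hA : A.PosSemidef) : 1 ≤ (1 + A).det := by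
  have hB : (1 + A).IsHermitian := isHermitian_one.add hA.1
  rw [hB.det_eq_prod_eigenvalues]
  simp only [RCLike.ofReal_real_eq_id, id_eq]
  refine Finset.one_le_prod fun i _ => ?_
  have hu := (EuclideanSpace.inner_eq_star_dotProduct (hB.eigenvectorBasis i)
    (hB.eigenvectorBasis i)).symm.trans (by
      rw [real_inner_self_eq_norm_sq, hB.eigenvectorBasis.orthonormal.1 i, one_pow])
  have h := hA.dotProduct_mulVec_nonneg (hB.eigenvectorBasis i).ofLp
  rw [hB.eigenvalues_eq, add_mulVec, one_mulVec, dotProduct_add]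
  rw [dotProduct_comm] at hu
  simp only [RCLike.re_to_real]
  linarith

/-- Testing `y ⬝ x` against `x = (A + b⁻¹)⁻¹ y`: the resolvent of a positive semidefinite matrix
at `-b⁻¹` is bounded by `b`. -/
theorem Matrix.PosSemidef.dotProduct_inv_add_smul_one_mulVec_mem_Icc {n : Type*} [Fintype n]
    [DecidableEq n] {A : Matrix n n ℝ} (hA : A.PosSemidef) {b : ℝ} (hb : 0 < b) (y : n → ℝ) :
    y ⬝ᵥ ((A + b⁻¹ • (1 : Matrix n n ℝ))⁻¹ *ᵥ y) ∈ Set.Icc 0 (b * (y ⬝ᵥ y)) := by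
  set B := A + b⁻¹ • (1 : Matrix n n ℝ) with hB
  have hBp : B.PosDef := PosDef.posSemidef_add hA (PosDef.one.smul (inv_pos.2 hb))
  set x := B⁻¹ *ᵥ y with hx
  have hBx : B *ᵥ x = y := by
    rw [hx, mulVec_mulVec, mul_nonsing_inv _ ((isUnit_iff_isUnit_det _).1 hBp.isUnit), one_mulVec]
  have h0 : 0 ≤ y ⬝ᵥ x := by simpa using hBp.inv.posSemidef.dotProduct_mulVec_nonneg y
  refine ⟨h0, ?_⟩
  have h1 : x ⬝ᵥ (A *ᵥ x) + b⁻¹ * (x ⬝ᵥ x) = y ⬝ᵥ x := by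
    rw [dotProduct_comm y, ← hBx, hB, add_mulVec, smul_mulVec, one_mulVec, dotProduct_add,
      dotProduct_smul, smul_eq_mul]
  have h2 : 0 ≤ x ⬝ᵥ (A *ᵥ x) := by simpa using hA.dotProduct_mulVec_nonneg x
  -- Cauchy–Schwarz in the form `2 b (y ⬝ x) ≤ b² (y ⬝ y) + x ⬝ x`
  have h3 : 0 ≤ (b • y - x) ⬝ᵥ (b • y - x) := by
    simpa using dotProduct_star_self_nonneg (b • y - x)
  simp only [sub_dotProduct, dotProduct_sub, smul_dotProduct, dotProduct_smul, smul_eq_mul,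
    dotProduct_comm x y] at h3
  have h4 : x ⬝ᵥ x ≤ b * (y ⬝ᵥ x) := by
    have : b⁻¹ * (x ⬝ᵥ x) ≤ y ⬝ᵥ x := by linarith
    rwa [inv_mul_le_iff₀ hb] at this
  have h5 : b * (y ⬝ᵥ x) ≤ b * (b * (y ⬝ᵥ y)) := by linarith
  exact le_of_mul_le_mul_left h5 hb

theorem posteriorPotential_nonneg {D L N₀ P : ℕ} {lam : Fin (L + 1) → ℝ} (hlam : ∀ l, 0 < lam l)
    (X : Matrix (Fin N₀) (Fin P) ℝ) {β : ℝ} (hβ : 0 < β) (y : Fin P → Fin D → ℝ)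
    (Q : Fin L → SPD D) : 0 ≤ posteriorPotential lam X β y Q := by
  have hS := posSemidef_sigma11 hlam X Q
  exact add_nonneg (hS.dotProduct_inv_add_smul_one_mulVec_mem_Icc hβ _).1
    (Real.log_nonneg (hS.smul hβ.le).one_le_det_one_add)

theorem posteriorPotential_le {D L N₀ P : ℕ} {lam : Fin (L + 1) → ℝ} (hlam : ∀ l, 0 < lam l)
    (X : Matrix (Fin N₀) (Fin P) ℝ) {β : ℝ} (hβ : 0 < β) (y : Fin P → Fin D → ℝ)
    (Q : Fin L → SPD D) :
    posteriorPotential lam X β y Q ≤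
      β * ((fun p : Fin P × Fin D => y p.1 p.2) ⬝ᵥ (fun p : Fin P × Fin D => y p.1 p.2)) +
        β * ((1 / ((N₀ : ℝ) * ∏ l, lam l)) * (Xᵀ * X).trace * (D * ∏ l, (Q l).1.trace)) := by
  have hS := posSemidef_sigma11 hlam X Q
  have hl := Finset.prod_pos fun l (_ : l ∈ Finset.univ) => hlam l
  have hX : 0 ≤ (Xᵀ * X).trace := by rw [trace_transpose_mul_self]; positivity
  refine add_le_add (hS.dotProduct_inv_add_smul_one_mulVec_mem_Icc hβ _).2 ?_
  refine (PosDef.add_posSemidef PosDef.one (hS.smul hβ.le)).log_det_le_trace_sub_card.trans ?_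
  rw [trace_add, trace_one, add_sub_cancel_left, trace_smul, smul_eq_mul, sigma11,
    trace_kronecker, trace_smul, smul_eq_mul]
  have := trace_layerProduct_le Q
  gcongr

/-! ### The Wishart product measures -/

theorem rateFunction_nonneg {D L : ℕ} (Q : Fin L → SPD D) : 0 ≤ rateFunction D L Q := by
  have h : ∑ _l : Fin L, (D : ℝ) ≤ ∑ l, ((Q l).1.trace - Real.log (Q l).1.det) :=
    Finset.sum_le_sum fun l _ => by
      have := (Q l).2.log_det_le_trace_sub_card
      rw [Fintype.card_fin] at this
      linarith
  rw [Finset.sum_const, Finset.card_univ, Fintype.card_fin, nsmul_eq_mul] at h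
  unfold rateFunction
  linarith

theorem rateFunction_one (D L : ℕ) :
    rateFunction D L (fun _ => ⟨1, PosDef.one⟩) = 0 := by
  simp [rateFunction]
  ring

theorem continuous_sum_trace_sub_log_det (D L : ℕ) :
    Continuous fun Q : Fin L → SPD D =>
      1 / 2 * ∑ l, ((Q l).1.trace - Real.log (Q l).1.det) := by
  refine continuous_const.mul (continuous_finsetSum _ fun l _ => ?_)
  have hQ : Continuous fun Q : Fin L → SPD D => (Q l).1 :=
    continuous_subtype_val.comp (continuous_apply l)
  exact hQ.matrix_trace.sub (hQ.matrix_det.log fun Q => (Q l).2.det_pos.ne')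

/-- Separation of the terms of the exponent linear in `N` from the rest of the density. -/
theorem prod_wishartDensity_eq {D L N : ℕ} (hN : 0 < N) (Q : Fin L → SPD D) :
    ∏ l, wishartDensity D ((1 / (N : ℝ)) • (1 : Matrix (Fin D) (Fin D) ℝ)) N (Q l) =
      ((wishartNormalizer D N)⁻¹) ^ L * (∏ l, (Q l).1.det ^ (-((D : ℝ) + 1) / 2)) *
        Real.exp (-(N * (1 / 2 * ∑ l, ((Q l).1.trace - Real.log (Q l).1.det)))) := by
  have hN' : (N : ℝ) ≠ 0 := by exact_mod_cast hN.ne'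
  have hinv : ((1 / (N : ℝ)) • (1 : Matrix (Fin D) (Fin D) ℝ))⁻¹ = (N : ℝ) • 1 := by
    refine inv_eq_right_inv ?_
    rw [smul_mul_smul_comm, one_mul, one_div, inv_mul_cancel₀ hN', one_smul]
  have hterm : ∀ l, wishartDensity D ((1 / (N : ℝ)) • (1 : Matrix (Fin D) (Fin D) ℝ)) N (Q l) =
      (wishartNormalizer D N)⁻¹ * (Q l).1.det ^ (-((D : ℝ) + 1) / 2) *
        Real.exp (-(N * (1 / 2 * ((Q l).1.trace - Real.log (Q l).1.det)))) := by
    intro l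
    have hdet := (Q l).2.det_pos
    rw [wishartDensity, hinv, smul_mul_assoc, one_mul, trace_smul, smul_eq_mul,
      ← wishartNormalizer, Real.rpow_def_of_pos hdet, Real.rpow_def_of_pos hdet, mul_assoc,
      ← Real.exp_add, ← Real.exp_add, div_eq_inv_mul]
    ring_nf
  simp only [hterm, Finset.prod_mul_distrib, Finset.prod_const, Finset.card_univ, Fintype.card_fin,
    ← Real.exp_sum, Finset.sum_neg_distrib, Finset.mul_sum]

/-- With `M = D + 1` the power of the determinant cancels and `exp (-M tr Q / 2)` is left. -/
theorem lintegral_det_rpow_mul_exp_ne_top (D L : ℕ) :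
    ∫⁻ Q : Fin L → SPD D, ENNReal.ofReal ((∏ l, (Q l).1.det ^ (-((D : ℝ) + 1) / 2)) *
      Real.exp (-(((D : ℝ) + 1) * (1 / 2 * ∑ l, ((Q l).1.trace - Real.log (Q l).1.det)))))
      ∂(Measure.pi fun _ : Fin L => lebesgueSPD D) ≠ ∞ := by
  have hint : Integrable
      (fun Q : Fin L → SPD D => ∏ l, Real.exp (-(((D : ℝ) + 1) / 2 * (Q l).1.trace)))
      (Measure.pi fun _ : Fin L => lebesgueSPD D) :=
    Integrable.fintype_prod (𝕜 := ℝ)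
      (f := fun _ : Fin L => fun Q : SPD D => Real.exp (-(((D : ℝ) + 1) / 2 * Q.1.trace)))
      fun _ => integrable_exp_neg_mul_trace D (by positivity)
  refine ne_of_eq_of_ne (lintegral_congr fun Q => ?_) hint.lintegral_lt_top.ne
  congr 1
  rw [Finset.mul_sum, Finset.mul_sum, ← Finset.sum_neg_distrib, Real.exp_sum,
    ← Finset.prod_mul_distrib]
  refine Finset.prod_congr rfl fun l _ => ?_
  rw [Real.rpow_def_of_pos (Q l).2.det_pos, ← Real.exp_add]
  ring_nf

theorem hasExponentialBounds_wishartProduct (D L : ℕ) :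
    HasExponentialBounds (fun N : ℕ => wishartProduct D L (fun _ => N)) (rateFunction D L) := by
  have hκ : Tendsto (fun N : ℕ => Real.log (((wishartNormalizer D N)⁻¹) ^ L) / N) atTop
      (𝓝 ((D : ℝ) * L / 2)) := by
    have h := (tendsto_log_wishartNormalizer D).const_mul (-(L : ℝ))
    rw [show -(L : ℝ) * -(D / 2 : ℝ) = (D : ℝ) * L / 2 by ring] at h
    refine h.congr fun N => ?_
    rw [Real.log_pow, Real.log_inv]
    ring
  refine HasExponentialBounds.of_laplace (ν := Measure.pi fun _ : Fin L => lebesgueSPD D)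
    (F := fun Q => 1 / 2 * ∑ l, ((Q l).1.trace - Real.log (Q l).1.det))
    (g := fun Q => ∏ l, (Q l).1.det ^ (-((D : ℝ) + 1) / 2))
    (continuous_sum_trace_sub_log_det D L) ?_ ?_ (lintegral_det_rpow_mul_exp_ne_top D L) ?_ hκ ?_
  · refine continuous_finsetProd _ fun l _ => ?_
    have hQ : Continuous fun Q : Fin L → SPD D => (Q l).1 :=
      continuous_subtype_val.comp (continuous_apply l)
    exact hQ.matrix_det.rpow_const fun Q => Or.inl (Q l).2.det_pos.ne'
  · exact fun Q => Finset.prod_pos fun l _ => Real.rpow_pos_of_pos (Q l).2.det_pos _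
  · filter_upwards [eventually_gt_atTop D] with N hN
    exact pow_pos (inv_pos.2 (wishartNormalizer_pos hN)) L
  · filter_upwards [eventually_gt_atTop 0] with N hN
    unfold wishartProduct
    congr 1
    funext Q
    rw [prod_wishartDensity_eq hN]

theorem hasExponentialBounds_posteriorMixing (D L : ℕ) {N₀ P : ℕ} {lam : Fin (L + 1) → ℝ}
    (hlam : ∀ l, 0 < lam l) (X : Matrix (Fin N₀) (Fin P) ℝ) {β : ℝ} (hβ : 0 < β)
    (y : Fin P → Fin D → ℝ) :
    HasExponentialBounds (fun N : ℕ => posteriorMixing lam X β y (fun _ : Fin L => N))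
      (rateFunction D L) := by
  refine (hasExponentialBounds_wishartProduct D L).tilt rateFunction_nonneg
    (rateFunction_one D L) (fun Q => ?_) fun Q => ?_
  · rw [ENNReal.ofReal_le_one, Real.exp_le_one_iff]
    linarith [posteriorPotential_nonneg hlam X hβ y Q]
  · set B : (Fin L → SPD D) → ℝ := fun Q =>
      β * ((fun p : Fin P × Fin D => y p.1 p.2) ⬝ᵥ (fun p : Fin P × Fin D => y p.1 p.2)) +
        β * ((1 / ((N₀ : ℝ) * ∏ l, lam l)) * (Xᵀ * X).trace * (D * ∏ l, (Q l).1.trace)) with hB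
    have hBc : Continuous B := by
      have hQ : ∀ l, Continuous fun Q : Fin L → SPD D => (Q l).1.trace := fun l =>
        (continuous_subtype_val.comp (continuous_apply l)).matrix_trace
      fun_prop
    refine ⟨Real.exp (-(1 / 2) * (B Q + 1)), Real.exp_pos _, ?_⟩
    filter_upwards [hBc.continuousAt.eventually_lt_const (lt_add_one (B Q))] with R hR
    apply ENNReal.ofReal_le_ofReal
    rw [Real.exp_le_exp]
    have h : posteriorPotential lam X β y R ≤ B R := posteriorPotential_le hlam X hβ y R
    linarith

theorem continuous_rateFunction (D L : ℕ) : Continuous (rateFunction D L) :=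
  (continuous_sum_trace_sub_log_det D L).sub continuous_const

theorem proposition5 (D L : ℕ) :
    SatisfiesLDP (fun N : ℕ => wishartProduct D L (fun _ => N))
      (fun Q => (rateFunction D L Q : EReal)) ∧
    ∀ (N₀ P : ℕ) (_ : 0 < N₀) (lam : Fin (L + 1) → ℝ) (_ : ∀ l, 0 < lam l)
      (X : Matrix (Fin N₀) (Fin P) ℝ) (β : ℝ) (_ : 0 < β) (y : Fin P → Fin D → ℝ),
      SatisfiesLDP (fun N : ℕ => posteriorMixing lam X β y (fun _ : Fin L => N))
        (fun Q => (rateFunction D L Q : EReal)) :=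
  ⟨(hasExponentialBounds_wishartProduct D L).satisfiesLDP (continuous_rateFunction D L)
    rateFunction_nonneg, fun _ _ _ _ hlam X _ hβ y =>
    (hasExponentialBounds_posteriorMixing D L hlam X hβ y).satisfiesLDP
      (continuous_rateFunction D L) rateFunction_nonneg⟩
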